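/- For a finite set $P$, the braid arrangement in $V=\mathbb{R}^P$ consists of the hyperplanes $\{x_i=x_j\}$ for $i\ne j$ in $P$. Its intersection poset $\mathcal{L}$ is the set of all intersections of sets of these hyperplanes (including the empty intersection $V$), ordered by reverse inclusion; let $\mu$ be its Möbius function. For a finite poset $P$, let $\mathcal{K}_P=\{x\in V : x_i<x_j \text{ whenever } i<_P j\}$ and define the Poincaré polynomial $$\mathrm{Poin}(P,t)=\sum_{k\ge 0} c_k(P)\,t^k,\qquad c_k(P)=\sum_{\substack{X\in\mathcal{L},\ X\cap\mathcal{K}_P\neq\varnothing\\ \operatorname{codim}X=k}}|\mu(V,X)| .$$ For $\bar a=(a_1,\dots,a_\ell)$ with nonnegative integer entries, let $P_{\bar a}$ be the disjoint union of $\ell$ mutually incomparable chains with $a_1,\dots,a_\ell$ elements, let $\mathbf{x}^{\bar a}=x_1^{a_1}\cdots x_\ell^{a_\ell}$, and let $e_j(\mathbf{x})$ be the $j$-th elementary symmetric polynomial in $x_1,\dots,x_\ell$. **Theorem.** For every integer $\ell\ge 1$, in the formal power series ring $\mathbb{Z}[t][[x_1,\dots,x_\ell]]$, $$\sum_{\bar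 a\in\{0,1,2,\dots\}^\ell}\mathrm{Poin}(P_{\bar a},t)\,\mathbf{x}^{\bar a}=\frac{1}{1-\sum_{j=1}^{\ell}e_j(\mathbf{x})\,(t-1)(2t-1)\cdots((j-1)t-1)} ,$$ where the product $(t-1)(2t-1)\cdots((j-1)t-1)$ is $1$ for $j=1$. -/

import Mathlib

noncomputable section

/-- A finite arrangement of (linear) hyperplanes in a real vector space `V`:
a finite set of subspaces of codimension one. -/
structure HyperplaneArrangement (V : Type*) [AddCommGroup V] [Module ℝ V] where
  hyperplanes : Set (Submodule ℝ V)
  finite_hyperplanes : hyperplanes.Finite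
  codim_one : ∀ H ∈ hyperplanes, Module.finrank ℝ (V ⧸ H) = 1

namespace HyperplaneArrangement

/-- The intersection poset of `A`: all intersections of sets of hyperplanes of `A`, including the
empty intersection `V = ⊤`, ordered by reverse inclusion. -/
abbrev IntersectionPoset {V : Type*} [AddCommGroup V] [Module ℝ V]
    (A : HyperplaneArrangement V) : Type _ :=
  {X : Submodule ℝ V // ∃ S : Set (Submodule ℝ V), S ⊆ A.hyperplanes ∧ X = sInf S}ᵒᵈ

/-- The intersection subspace of `V` underlying an element of the intersection poset. -/
def IntersectionPoset.space {V : Type*} [AddCommGroup V] [Module ℝ V]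
    {A : HyperplaneArrangement V} (X : A.IntersectionPoset) : Submodule ℝ V :=
  (OrderDual.ofDual X).1

/-- The order on the intersection poset is reverse inclusion. -/
theorem IntersectionPoset.le_iff {V : Type*} [AddCommGroup V] [Module ℝ V]
    {A : HyperplaneArrangement V} (X Y : A.IntersectionPoset) :
    X ≤ Y ↔ Y.space ≤ X.space := Iff.rfl

/-- The ambient space `V`, viewed as the bottom element of the intersection poset. -/
def IntersectionPoset.ambient {V : Type*} [AddCommGroup V] [Module ℝ V]
    (A : HyperplaneArrangement V) : A.IntersectionPoset :=
  OrderDual.toDual ⟨⊤, ∅, Set.empty_subset _, sInf_empty.symm⟩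

instance instFiniteIntersectionPoset {V : Type*} [AddCommGroup V] [Module ℝ V]
    (A : HyperplaneArrangement V) : Finite A.IntersectionPoset := by
  have h : {X : Submodule ℝ V |
      ∃ S : Set (Submodule ℝ V), S ⊆ A.hyperplanes ∧ X = sInf S}.Finite := by
    refine (A.finite_hyperplanes.powerset.image sInf).subset ?_
    rintro X ⟨S, hS, rfl⟩
    exact ⟨S, hS, rfl⟩
  exact h.to_subtype

instance instFintypeIntersectionPoset {V : Type*} [AddCommGroup V] [Module ℝ V]
    (A : HyperplaneArrangement V) : Fintype A.IntersectionPoset :=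
  Fintype.ofFinite _

open Classical in
instance instLocallyFiniteOrderIntersectionPoset {V : Type*} [AddCommGroup V] [Module ℝ V]
    (A : HyperplaneArrangement V) : LocallyFiniteOrder A.IntersectionPoset :=
  Fintype.toLocallyFiniteOrder

open Classical in
/-- The value `μ(V, X)` of the Möbius function of the intersection poset. -/
def moebius {V : Type*} [AddCommGroup V] [Module ℝ V]
    (A : HyperplaneArrangement V) (X : A.IntersectionPoset) : ℤ :=
  IncidenceAlgebra.mu ℤ (IntersectionPoset.ambient A) X

open Classical in
/-- The `k`-th signless Whitney number of the first kind of a cone `K` of `A`: the sum of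
`|μ(V, X)|` over all intersections `X` of `A` of codimension `k` that meet `K`. -/
def whitney {V : Type*} [AddCommGroup V] [Module ℝ V]
    (A : HyperplaneArrangement V) (K : Set V) (k : ℕ) : ℕ :=
  ∑ X : A.IntersectionPoset with
    ((X.space : Set V) ∩ K).Nonempty ∧ Module.finrank ℝ (V ⧸ X.space) = k,
    (A.moebius X).natAbs

/-- The Poincaré polynomial `∑_{k=0}^{dim V} c_k t^k` of a cone `K` of `A`. -/
def poin {V : Type*} [AddCommGroup V] [Module ℝ V]
    (A : HyperplaneArrangement V) (K : Set V) : Polynomial ℤ :=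
  ∑ k ∈ Finset.range (Module.finrank ℝ V + 1),
    Polynomial.C (A.whitney K k : ℤ) * Polynomial.X ^ k

end HyperplaneArrangement

/-- The hyperplane `x_i = x_j` in `ℝ^P`. -/
def braidHyperplane {P : Type*} (i j : P) : Submodule ℝ (P → ℝ) where
  carrier := {x | x i = x j}
  add_mem' := by
    intro x y hx hy
    simp only [Set.mem_ofPred_eq, Pi.add_apply] at *
    rw [hx, hy]
  zero_mem' := rfl
  smul_mem' := by
    intro c x hx
    simp only [Set.mem_ofPred_eq, Pi.smul_apply] at *
    rw [hx]

theorem finrank_quotient_braidHyperplane {P : Type*} (i j : P) (hij : i ≠ j) :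
    Module.finrank ℝ ((P → ℝ) ⧸ braidHyperplane i j) = 1 := by
  classical
  let f : (P → ℝ) →ₗ[ℝ] ℝ :=
    (LinearMap.proj i : (P → ℝ) →ₗ[ℝ] ℝ) - (LinearMap.proj j : (P → ℝ) →ₗ[ℝ] ℝ)
  have hf : Function.Surjective f := by
    intro c
    refine ⟨Pi.single i c, ?_⟩
    simp [f, hij.symm]
  have hk : braidHyperplane i j = LinearMap.ker f := by
    ext x
    simp only [f, LinearMap.mem_ker, LinearMap.sub_apply, LinearMap.proj_apply, sub_eq_zero]
    rfl
  rw [hk, (f.quotKerEquivOfSurjective hf).finrank_eq, Module.finrank_self]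

/-- The braid arrangement in `ℝ^P`, consisting of all the hyperplanes `x_i = x_j` with `i ≠ j`. -/
def braidArrangement (P : Type*) [Finite P] : HyperplaneArrangement (P → ℝ) where
  hyperplanes := {H | ∃ i j : P, i ≠ j ∧ H = braidHyperplane i j}
  finite_hyperplanes := by
    refine (Set.finite_range fun p : P × P => braidHyperplane p.1 p.2).subset ?_
    rintro H ⟨i, j, -, rfl⟩
    exact ⟨(i, j), rfl⟩
  codim_one := by
    rintro H ⟨i, j, hij, rfl⟩
    exact finrank_quotient_braidHyperplane i j hij

/-- The cone of a poset `P`: all points `x` of `ℝ^P` with `x_i < x_j` whenever `i <_P j`. -/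
def posetCone (P : Type*) [PartialOrder P] : Set (P → ℝ) :=
  {x | ∀ i j : P, i < j → x i < x j}

/-- The Poincaré polynomial `Poin(P, t)` of a finite poset `P`. -/
def posetPoin (P : Type*) [PartialOrder P] [Finite P] : Polynomial ℤ :=
  (braidArrangement P).poin (posetCone P)

/-- The disjoint union of chains of sizes `a_1, …, a_ℓ`; elements of different chains are
incomparable (this is Mathlib's order on a sigma type). -/
abbrev ChainUnion {ℓ : ℕ} (a : Fin ℓ → ℕ) : Type := Σ i : Fin ℓ, Fin (a i)

/-- The formal power series `∑_a Poin(P_a, t) x^a` over all `a ∈ ℕ^ℓ`, given by its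
coefficients. -/
def chainPoinSeries (ℓ : ℕ) : MvPowerSeries (Fin ℓ) (Polynomial ℤ) :=
  fun a : Fin ℓ →₀ ℕ => posetPoin (ChainUnion a)

end

/-! Everything reduces to counting permutations. In the braid arrangement, μ(V, X) is the sum of the
signs of the permutations whose space of invariant functions is exactly X
(`moebius_braidArrangement`). All these signs equal (-1)^(codim X), so |μ(V, X)| is their number,
and Poin(P, t) is the sum of t^(codim) over the permutations fixing some point of the cone
(`posetPoin_eq_sum_perm`).

For nonempty P this gives the recursion ∑_U ∏_{i<|U|} (i t - 1) · Poin(P \ U, t) = 0 over the sets U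
of minimal elements (`sum_prod_mul_posetPoin_eq_zero`). The product enumerates the permutations of
U, weighted by (-1)^(number of orbits) t^(codim). Gluing such a permutation to a compatible one of P
\ U gives a compatible permutation τ of P preserving U. For fixed τ, the sets U are the unions of
τ-orbits made of minimal elements. Such an orbit exists, since an invariant strictly monotone
function attains its minimum, so the signed sum over U vanishes.

For a union of chains, U amounts to a set T of nonempty chains, and deleting U shortens those chains
by one. As the denominator is ∑_T x^T ∏_{i<|T|} (i t - 1), the recursion says that the coefficients
of the product at nonzero exponents vanish. -/

/-! ### Codimension of the invariant functions of a permutation -/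

/-- The functions on `α` that are invariant under the permutation `σ`. -/
def fixedFunctions {α : Type*} (σ : Equiv.Perm α) : Submodule ℝ (α → ℝ) where
  carrier := {x | ∀ p, x (σ p) = x p}
  add_mem' := by
    intro x y hx hy p
    simp [hx p, hy p]
  zero_mem' := fun _ => rfl
  smul_mem' := by
    intro c x hx p
    simp [hx p]

theorem mem_fixedFunctions {α : Type*} {σ : Equiv.Perm α} {x : α → ℝ} :
    x ∈ fixedFunctions σ ↔ ∀ p, x (σ p) = x p := Iff.rfl

/-- The codimension of the space of invariant functions of a permutation. -/
noncomputable def permCodim {α : Type*} (σ : Equiv.Perm α) : ℕ :=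
  Module.finrank ℝ ((α → ℝ) ⧸ fixedFunctions σ)

theorem permCodim_add_finrank {α : Type*} [Fintype α] (σ : Equiv.Perm α) :
    permCodim σ + Module.finrank ℝ (fixedFunctions σ) = Fintype.card α := by
  rw [permCodim, Submodule.finrank_quotient_add_finrank, Module.finrank_fintype_fun_eq_card]

theorem finrank_fixedFunctions_permCongr {α β : Type*} (e : α ≃ β) (σ : Equiv.Perm α) :
    Module.finrank ℝ (fixedFunctions (e.permCongr σ)) = Module.finrank ℝ (fixedFunctions σ) := by
  have h : (fixedFunctions (e.permCongr σ)).map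
      (LinearEquiv.funCongrLeft ℝ ℝ e : (β → ℝ) →ₗ[ℝ] (α → ℝ)) = fixedFunctions σ := by
    ext x
    rw [Submodule.mem_map_equiv]
    simp only [mem_fixedFunctions, LinearEquiv.funCongrLeft_symm, LinearEquiv.funCongrLeft_apply,
      LinearMap.funLeft_apply, Equiv.permCongr_apply, Equiv.symm_apply_apply]
    exact e.symm.forall_congr_left.trans (by simp)
  rw [← h]
  exact (LinearEquiv.finrank_map_eq _ _).symm

theorem permCodim_permCongr {α β : Type*} [Fintype α] [Fintype β] (e : α ≃ β)
    (σ : Equiv.Perm α) : permCodim (e.permCongr σ) = permCodim σ := by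
  have h₁ := permCodim_add_finrank σ
  have h₂ := permCodim_add_finrank (e.permCongr σ)
  rw [finrank_fixedFunctions_permCongr, ← Fintype.card_congr e] at h₂
  omega

theorem finrank_fixedFunctions_sumCongr {α β : Type*} [Finite α] [Finite β]
    (σ : Equiv.Perm α) (ρ : Equiv.Perm β) :
    Module.finrank ℝ (fixedFunctions (Equiv.Perm.sumCongr σ ρ)) =
      Module.finrank ℝ (fixedFunctions σ) + Module.finrank ℝ (fixedFunctions ρ) := by
  let e : fixedFunctions (Equiv.Perm.sumCongr σ ρ) ≃ₗ[ℝ] fixedFunctions σ × fixedFunctions ρ :=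
    { toFun := fun x => (⟨fun p => x.1 (Sum.inl p), fun p => x.2 (Sum.inl p)⟩,
        ⟨fun p => x.1 (Sum.inr p), fun p => x.2 (Sum.inr p)⟩)
      invFun := fun y => ⟨Sum.elim y.1.1 y.2.1, by
        rintro (p | p)
        · exact y.1.2 p
        · exact y.2.2 p⟩
      left_inv := by
        rintro ⟨x, hx⟩
        ext (p | p) <;> rfl
      right_inv := fun y => rfl
      map_add' := fun x y => rfl
      map_smul' := fun c x => rfl }
  rw [e.finrank_eq, Module.finrank_prod]

theorem permCodim_sumCongr {α β : Type*} [Fintype α] [Fintype β]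
    (σ : Equiv.Perm α) (ρ : Equiv.Perm β) :
    permCodim (Equiv.Perm.sumCongr σ ρ) = permCodim σ + permCodim ρ := by
  have h₁ := permCodim_add_finrank σ
  have h₂ := permCodim_add_finrank ρ
  have h₃ := permCodim_add_finrank (Equiv.Perm.sumCongr σ ρ)
  rw [finrank_fixedFunctions_sumCongr, Fintype.card_sum] at h₃
  omega

theorem permCodim_subtypeCongr {α : Type*} [Fintype α] {p : α → Prop} [DecidablePred p]
    (σ : Equiv.Perm {a // p a}) (ρ : Equiv.Perm {a // ¬ p a}) :
    permCodim (σ.subtypeCongr ρ) = permCodim σ + permCodim ρ := by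
  rw [Equiv.Perm.subtypeCongr, permCodim_permCongr, permCodim_sumCongr]

theorem permCodim_of_isEmpty {α : Type*} [IsEmpty α] (σ : Equiv.Perm α) : permCodim σ = 0 := by
  have := Fintype.ofIsEmpty (α := α)
  have h := permCodim_add_finrank σ
  rw [Fintype.card_eq_zero] at h
  omega

-- A permutation of `Option α` arises from one of `α` either by adding `none` as a fixed point,
-- which gives one more free coordinate, or by inserting `none` into the cycle of `i`, where its
-- value is forced. Only the second raises the codimension.
open Equiv.Perm in
theorem permCodim_decomposeOption_symm {α : Type*} [Fintype α] [DecidableEq α]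
    (i : Option α) (σ : Equiv.Perm α) :
    permCodim (decomposeOption.symm (i, σ)) = permCodim σ + if i = none then 0 else 1 := by
  set τ := decomposeOption.symm (i, σ) with hτ
  have happ : ∀ p, τ p = Equiv.swap none i (Equiv.optionCongr σ p) := fun p => by
    rw [hτ, decomposeOption_symm_apply]; rfl
  have h₁ := permCodim_add_finrank σ
  have h₂ := permCodim_add_finrank τ
  rw [Fintype.card_option] at h₂
  cases i with
  | none =>
    have hs : ∀ p, τ (some p) = some (σ p) := fun p => by simp [happ]
    have hn : τ none = none := by simp [happ]
    let e : fixedFunctions τ ≃ₗ[ℝ] ℝ × fixedFunctions σ :=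
      { toFun := fun x => (x.1 none, ⟨fun p => x.1 (some p), fun p => by
          have := x.2 (some p); rwa [hs] at this⟩)
        invFun := fun y => ⟨fun p => p.elim y.1 y.2.1, by
          rintro (_ | p)
          · rw [hn]
          · rw [hs]; exact y.2.2 p⟩
        left_inv := by
          rintro ⟨x, hx⟩
          ext (_ | p) <;> rfl
        right_inv := fun y => rfl
        map_add' := fun x y => rfl
        map_smul' := fun c x => rfl }
    have := e.finrank_eq
    rw [Module.finrank_prod, Module.finrank_self] at this
    simp only [if_true]
    omega
  | some i =>
    have hs : ∀ p, σ p ≠ i → τ (some p) = some (σ p) := fun p hp => by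
      rw [happ]
      simp only [Equiv.optionCongr_apply, Option.map_some]
      exact Equiv.swap_apply_of_ne_of_ne (by simp) (by simpa using hp)
    have hi : ∀ p, σ p = i → τ (some p) = none := fun p hp => by
      simp [happ, hp]
    have hn : τ none = some i := by simp [happ]
    have key : ∀ x ∈ fixedFunctions τ, x (some i) = x none := fun x hx => by
      have := hx none; rwa [hn] at this
    let e : fixedFunctions τ ≃ₗ[ℝ] fixedFunctions σ :=
      { toFun := fun x => ⟨fun p => x.1 (some p), fun p => by
          have := x.2 (some p)
          by_cases hp : σ p = i
          · rw [hi p hp] at this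
            simp only [hp]
            rw [key _ x.2, this]
          · rwa [hs p hp] at this⟩
        invFun := fun y => ⟨fun p => p.elim (y.1 i) y.1, by
          rintro (_ | p)
          · rw [hn]; rfl
          · by_cases hp : σ p = i
            · rw [hi p hp]
              have := y.2 p
              rw [hp] at this
              exact this
            · rw [hs p hp]; exact y.2 p⟩
        left_inv := by
          rintro ⟨x, hx⟩
          ext (_ | p)
          · exact key x hx
          · rfl
        right_inv := fun y => rfl
        map_add' := fun x y => rfl
        map_smul' := fun c x => rfl }
    have := e.finrank_eq
    simp only [reduceCtorEq, if_false]
    omega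

theorem sign_decomposeOption_symm {α : Type*} [Fintype α] [DecidableEq α] (i : Option α)
    (σ : Equiv.Perm α) : Equiv.Perm.sign (Equiv.Perm.decomposeOption.symm (i, σ)) =
      (if i = none then 1 else -1) * Equiv.Perm.sign σ := by
  rw [Equiv.Perm.decomposeOption_symm_apply, Equiv.Perm.sign_mul, Equiv.Perm.sign_swap',
    Equiv.optionCongr_sign]
  simp only [eq_comm]

/-- By induction on the set: inserting a new point into an existing cycle flips the sign and raises
the codimension by one, while adding a fixed point changes neither. -/
theorem sign_eq_neg_one_pow_permCodim {α : Type*} [Fintype α] [DecidableEq α]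
    (σ : Equiv.Perm α) : (Equiv.Perm.sign σ : ℤ) = (-1) ^ permCodim σ := by
  suffices h : ∀ (β : Type _) [Fintype β], ∀ [DecidableEq β] (σ : Equiv.Perm β),
      (Equiv.Perm.sign σ : ℤ) = (-1) ^ permCodim σ from h α σ
  intro β _
  refine Fintype.induction_empty_option (P := fun β _ => ∀ [DecidableEq β] (σ : Equiv.Perm β),
      (Equiv.Perm.sign σ : ℤ) = (-1) ^ permCodim σ) ?_ ?_ ?_ β
  · intro α β _ e h _ σ
    classical
    let _ := Fintype.ofEquiv β e.symm
    have := h (e.symm.permCongr σ)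
    rw [permCodim_permCongr, Equiv.Perm.sign_permCongr] at this
    convert this
  · intro _ σ
    rw [permCodim_of_isEmpty, Subsingleton.elim σ 1]
    simp
  · intro α _ h _ τ
    classical
    obtain ⟨⟨i, σ⟩, rfl⟩ := Equiv.Perm.decomposeOption.symm.surjective τ
    have h₁ := permCodim_decomposeOption_symm i σ
    have h₂ := h σ
    rw [h₁, pow_add, ← h₂]
    convert congrArg (Units.val : ℤˣ → ℤ) (sign_decomposeOption_symm i σ) using 1
    · congr!
    · rw [Units.val_mul]
      split_ifs <;> simp

/-- Each new point is either fixed (weight 1) or inserted into a cycle next to one of the n old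
points (weight s each), contributing the factor 1 + n s. -/
theorem sum_pow_permCodim {R : Type*} [CommRing R] (s : R) (α : Type*) [Fintype α]
    [DecidableEq α] :
    ∑ σ : Equiv.Perm α, s ^ permCodim σ = ∏ i ∈ Finset.range (Fintype.card α), (1 + i * s) := by
  suffices h : ∀ (β : Type _) [Fintype β], ∀ [DecidableEq β], ∑ σ : Equiv.Perm β,
      s ^ permCodim σ = ∏ i ∈ Finset.range (Fintype.card β), (1 + i * s) from h α
  intro β _
  refine Fintype.induction_empty_option (P := fun β _ => ∀ [DecidableEq β], ∑ σ : Equiv.Perm β,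
      s ^ permCodim σ = ∏ i ∈ Finset.range (Fintype.card β), (1 + i * s)) ?_ ?_ ?_ β
  · intro α β _ e h _
    classical
    let _ := Fintype.ofEquiv β e.symm
    rw [← Fintype.card_congr e, ← h]
    refine (Fintype.sum_equiv e.permCongr _ _ fun σ => ?_).symm
    rw [permCodim_permCongr]
  · intro _
    rw [Fintype.sum_unique, permCodim_of_isEmpty]
    simp
  · intro α _ h _
    classical
    have : ∑ τ : Equiv.Perm (Option α), s ^ permCodim τ =
        ∑ q : Option α × Equiv.Perm α, s ^ permCodim (Equiv.Perm.decomposeOption.symm q) :=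
      Fintype.sum_equiv Equiv.Perm.decomposeOption _ _ fun τ => by simp
    convert this
    simp_rw [Fintype.sum_prod_type, permCodim_decomposeOption_symm, pow_add, ← Finset.sum_mul]
    rw [Fintype.sum_option, h, Fintype.card_option, Finset.prod_range_succ]
    simp
    ring

/-! ### The Möbius function of the braid arrangement -/

open HyperplaneArrangement in
/-- The space of functions invariant under a permutation, as an intersection of hyperplanes of the
braid arrangement. -/
def fixedFlat {P : Type*} [Finite P] (σ : Equiv.Perm P) : (braidArrangement P).IntersectionPoset :=
  OrderDual.toDual ⟨fixedFunctions σ, {H | ∃ i, σ i ≠ i ∧ H = braidHyperplane (σ i) i}, by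
    rintro H ⟨i, hi, rfl⟩
    exact ⟨_, _, hi, rfl⟩, by
    ext x
    simp only [mem_fixedFunctions, Submodule.mem_sInf, Set.mem_ofPred_eq]
    constructor
    · rintro h H ⟨i, -, rfl⟩
      exact h i
    · intro h i
      by_cases hi : σ i = i
      · rw [hi]
      · exact h _ ⟨i, hi, rfl⟩⟩

open HyperplaneArrangement in
theorem exists_le_braidHyperplane {P : Type*} [Finite P] (X : (braidArrangement P).IntersectionPoset)
    (hX : X ≠ IntersectionPoset.ambient _) : ∃ i j, i ≠ j ∧ X.space ≤ braidHyperplane i j := by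
  obtain ⟨S, hS, hXS⟩ := (OrderDual.ofDual X).2
  have hne : S.Nonempty := by
    by_contra h
    rw [Set.not_nonempty_iff_eq_empty] at h
    refine hX (OrderDual.ofDual.injective (Subtype.ext ?_))
    rw [hXS, h, sInf_empty]
    rfl
  obtain ⟨H, hH⟩ := hne
  obtain ⟨i, j, hij, rfl⟩ := hS hH
  exact ⟨i, j, hij, hXS.le.trans (sInf_le hH)⟩

/-- The signs of the permutations fixing every point of a proper flat cancel. -/
theorem sum_sign_eq_zero {P : Type*} [Fintype P] [DecidableEq P] (S : Submodule ℝ (P → ℝ))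
    [DecidablePred fun σ : Equiv.Perm P => S ≤ fixedFunctions σ] {i j : P} (hij : i ≠ j)
    (h : S ≤ braidHyperplane i j) :
    ∑ σ : Equiv.Perm P with S ≤ fixedFunctions σ, (Equiv.Perm.sign σ : ℤ) = 0 := by
  have hswap : ∀ x ∈ S, ∀ p, x (Equiv.swap i j p) = x p := fun x hx p => by
    have hx : x i = x j := h hx
    by_cases hi : p = i
    · rw [hi, Equiv.swap_apply_left, hx]
    · by_cases hj : p = j
      · rw [hj, Equiv.swap_apply_right, hx]
      · rw [Equiv.swap_apply_of_ne_of_ne hi hj]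
  -- Points of `S` have equal coordinates at `i` and `j`, so multiplying by the transposition keeps
  -- them invariant and reverses the sign.
  refine Finset.sum_involution (fun σ _ => Equiv.swap i j * σ) ?_ ?_ ?_ ?_
  · intro σ _
    simp [Equiv.Perm.sign_swap hij]
  · intro σ _ _ he
    exact hij (Equiv.swap_eq_one_iff.1 (mul_eq_right.1 he))
  · intro σ hσ
    simp only [Finset.mem_filter, Finset.mem_univ, true_and] at hσ ⊢
    intro x hx p
    rw [Equiv.Perm.mul_apply, hswap x hx]
    exact hσ hx p
  · intro σ _
    simp

-- The sums of signs satisfy the recursion defining μ: summed over the flats between V and X they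
-- run over all permutations fixing X pointwise. The total is 0 by `sum_sign_eq_zero` if X ≠ V, and
-- 1 if X = V, where only the identity remains.
open HyperplaneArrangement Classical in
theorem moebius_braidArrangement {P : Type*} [Fintype P] [DecidableEq P]
    (X : (braidArrangement P).IntersectionPoset) :
    (braidArrangement P).moebius X =
      ∑ σ : Equiv.Perm P with fixedFlat σ = X, (Equiv.Perm.sign σ : ℤ) := by
  induction X using WellFoundedLT.induction with
  | ind X ih =>
  have hbot : ∀ Y : (braidArrangement P).IntersectionPoset, IntersectionPoset.ambient (braidArrangement P) ≤ Y :=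
    fun Y => (IntersectionPoset.le_iff _ _).2 le_top
  have hmem : ∀ Y, Y ∈ Finset.Icc (IntersectionPoset.ambient (braidArrangement P)) X ↔ Y ≤ X := fun Y => by
    simp [hbot]
  have htot : ∑ Y ∈ Finset.Icc (IntersectionPoset.ambient (braidArrangement P)) X, ∑ σ : Equiv.Perm P with fixedFlat σ = Y,
      (Equiv.Perm.sign σ : ℤ) = if IntersectionPoset.ambient (braidArrangement P) = X then 1 else 0 := by
    have : ∑ Y ∈ Finset.Icc (IntersectionPoset.ambient (braidArrangement P)) X, ∑ σ : Equiv.Perm P with fixedFlat σ = Y,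
        (Equiv.Perm.sign σ : ℤ) =
        ∑ σ : Equiv.Perm P with X.space ≤ fixedFunctions σ, (Equiv.Perm.sign σ : ℤ) := by
      rw [← Finset.sum_fiberwise_of_maps_to (s := Finset.univ.filter
        fun σ : Equiv.Perm P => X.space ≤ fixedFunctions σ) (t := Finset.Icc (IntersectionPoset.ambient (braidArrangement P)) X) (g := fixedFlat)]
      · refine Finset.sum_congr rfl fun Y hY => Finset.sum_congr ?_ fun _ _ => rfl
        ext σ
        simp only [Finset.mem_filter, Finset.mem_univ, true_and, iff_and_self]
        rintro rfl
        exact (hmem _).1 hY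
      · intro σ hσ
        exact (hmem _).2 (Finset.mem_filter.1 hσ).2
    rw [this]
    split_ifs with hX
    · subst hX
      have : (Finset.univ.filter fun σ : Equiv.Perm P =>
          (IntersectionPoset.ambient (braidArrangement P)).space ≤ fixedFunctions σ) = {1} := by
        ext σ
        simp only [Finset.mem_filter, Finset.mem_univ, true_and, Finset.mem_singleton]
        constructor
        · intro h
          ext p
          have := h (show Pi.single p (1 : ℝ) ∈ (⊤ : Submodule ℝ (P → ℝ)) from trivial) p
          by_contra hp
          rw [Equiv.Perm.one_apply] at hp
          simp [hp] at this
        · rintro rfl x _ p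
          rfl
      rw [this]
      simp
    · obtain ⟨i, j, hij, h⟩ := exists_le_braidHyperplane X (Ne.symm hX)
      exact sum_sign_eq_zero _ hij h
  have hmu : ∑ Y ∈ Finset.Icc (IntersectionPoset.ambient (braidArrangement P)) X,
      (braidArrangement P).moebius Y =
        if IntersectionPoset.ambient (braidArrangement P) = X then 1 else 0 :=
    IncidenceAlgebra.sum_Icc_mu_right _ _
  -- Both functions have the same total over the interval and agree strictly below `X` by induction,
  -- hence agree at `X`.
  rw [← htot] at hmu
  rw [← Finset.insert_erase ((hmem X).2 le_rfl),
    Finset.sum_insert (Finset.notMem_erase _ _), Finset.sum_insert (Finset.notMem_erase _ _),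
    Finset.sum_congr rfl fun Y hY => ih Y ?_] at hmu
  · exact add_right_cancel hmu
  · rw [Finset.mem_erase, hmem] at hY
    exact lt_of_le_of_ne hY.2 hY.1

-- No cancellation occurs: the sign of a permutation depends only on the codimension of its flat.
open HyperplaneArrangement Classical in
theorem natAbs_moebius_braidArrangement {P : Type*} [Fintype P] [DecidableEq P]
    (X : (braidArrangement P).IntersectionPoset) :
    ((braidArrangement P).moebius X).natAbs =
      (Finset.univ.filter fun σ : Equiv.Perm P => fixedFlat σ = X).card := by
  rw [moebius_braidArrangement, Finset.sum_congr rfl (g := fun _ =>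
    (-1) ^ Module.finrank ℝ ((P → ℝ) ⧸ X.space))]
  · simp [Int.natAbs_mul, Int.natAbs_pow]
  · intro σ hσ
    obtain rfl := (Finset.mem_filter.1 hσ).2
    exact sign_eq_neg_one_pow_permCodim σ

/-! ### Poincaré polynomials as sums over compatible permutations -/

/-- A permutation of a poset is compatible if some strictly monotone real function is invariant
under it. -/
def IsCompatible {P : Type*} [PartialOrder P] (σ : Equiv.Perm P) : Prop :=
  ((fixedFunctions σ : Set (P → ℝ)) ∩ posetCone P).Nonempty

open HyperplaneArrangement Classical in
/-- The Poincaré polynomial of a poset counts the compatible permutations by codimension. -/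
theorem posetPoin_eq_sum_perm (P : Type*) [PartialOrder P] [Fintype P]
    [DecidableEq P] :
    posetPoin P = ∑ σ : Equiv.Perm P with IsCompatible σ,
      (Polynomial.X : Polynomial ℤ) ^ permCodim σ := by
  have hw : ∀ k, (braidArrangement P).whitney (posetCone P) k =
      (Finset.univ.filter fun σ : Equiv.Perm P => IsCompatible σ ∧ permCodim σ = k).card := by
    intro k
    rw [whitney, Finset.card_eq_sum_card_fiberwise (f := fixedFlat)
      (t := Finset.univ.filter fun X : (braidArrangement P).IntersectionPoset =>
        ((X.space : Set (P → ℝ)) ∩ posetCone P).Nonempty ∧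
          Module.finrank ℝ ((P → ℝ) ⧸ X.space) = k)]
    · refine Finset.sum_congr rfl fun X hX => ?_
      rw [natAbs_moebius_braidArrangement]
      congr 1
      ext σ
      simp only [Finset.mem_filter, Finset.mem_univ, true_and, iff_and_self]
      rintro rfl
      exact (Finset.mem_filter.1 hX).2
    · intro σ hσ
      simp only [Finset.coe_filter, Finset.mem_univ, true_and, Set.mem_ofPred_eq] at hσ ⊢
      exact hσ
  rw [posetPoin, poin, ← Finset.sum_fiberwise_of_maps_to (g := permCodim)
    (t := Finset.range (Module.finrank ℝ (P → ℝ) + 1))]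
  · refine Finset.sum_congr rfl fun k _ => ?_
    rw [hw, Finset.sum_congr rfl (g := fun _ => (Polynomial.X : Polynomial ℤ) ^ k),
      Finset.sum_const, Finset.filter_filter]
    · simp
    · intro σ hσ
      rw [(Finset.mem_filter.1 hσ).2]
  · intro σ _
    have := permCodim_add_finrank σ
    rw [Finset.mem_range, Module.finrank_fintype_fun_eq_card]
    omega

/-! ### Orbits, gluing and the recursion on minimal elements -/

theorem apply_eq_of_sameCycle {α : Type*} [Finite α] {σ : Equiv.Perm α} {x : α → ℝ}
    (hx : x ∈ fixedFunctions σ) {p q : α} (h : σ.SameCycle p q) : x p = x q := by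
  obtain ⟨n, -, -, rfl⟩ := h.exists_pow_eq'
  clear h
  induction n with
  | zero => rfl
  | succ n ih => rw [pow_succ', Equiv.Perm.mul_apply, hx, ih]

theorem sameCycle_subtypeCongr {α : Type*} {p : α → Prop} [DecidablePred p]
    (σ : Equiv.Perm {a // p a}) (ρ : Equiv.Perm {a // ¬ p a}) {u v : {a // p a}}
    (h : (σ.subtypeCongr ρ).SameCycle u v) : σ.SameCycle u v := by
  obtain ⟨n, hn⟩ := h
  refine ⟨n, Subtype.ext ?_⟩
  rw [← hn]
  have : (σ.subtypeCongr ρ) ^ n = (σ ^ n).subtypeCongr (ρ ^ n) :=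
    (map_zpow (Equiv.Perm.subtypeCongrHom p) (σ, ρ) n).symm
  rw [this, Equiv.Perm.subtypeCongr.left_apply_subtype]

/-- The orbits of `σ` are the orbits of the glued permutation that lie in the set. -/
theorem finrank_fixedFunctions_eq_card_image {α : Type*} [Finite α]
    {U : Finset α} [DecidablePred (· ∈ U)] (σ : Equiv.Perm {a // a ∈ U})
    (ρ : Equiv.Perm {a // ¬ a ∈ U}) (τ : Equiv.Perm α) (hτ : τ = σ.subtypeCongr ρ)
    [DecidableEq (Quotient (Equiv.Perm.SameCycle.setoid τ))] :
    Module.finrank ℝ (fixedFunctions σ) =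
      (U.image (Quotient.mk (Equiv.Perm.SameCycle.setoid τ))).card := by
  set D := U.image (Quotient.mk (Equiv.Perm.SameCycle.setoid τ)) with hD
  let f : {a // a ∈ U} → D := fun u => ⟨Quotient.mk _ u.1, Finset.mem_image_of_mem _ u.2⟩
  have hf : Function.Surjective f := by
    rintro ⟨q, hq⟩
    obtain ⟨u, hu, rfl⟩ := Finset.mem_image.1 hq
    exact ⟨⟨u, hu⟩, rfl⟩
  -- Invariant functions are exactly the pullbacks along the map `f` to orbits; for the converse,
  -- evaluate at any chosen representative.
  have hrange : LinearMap.range (LinearMap.funLeft ℝ ℝ f) = fixedFunctions σ := by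
    ext x
    rw [LinearMap.mem_range]
    constructor
    · rintro ⟨y, rfl⟩ u
      rw [LinearMap.funLeft_apply, LinearMap.funLeft_apply]
      congr 1
      refine Subtype.ext (Quotient.sound ?_)
      have : ((σ u : {a // a ∈ U}) : α) = τ u := by
        rw [hτ, Equiv.Perm.subtypeCongr.left_apply_subtype]
      rw [this]
      exact Equiv.Perm.sameCycle_apply_left.2 (Equiv.Perm.SameCycle.refl _ _)
    · intro hx
      refine ⟨fun d => x (Function.surjInv hf d), funext fun u => ?_⟩
      rw [LinearMap.funLeft_apply]
      refine apply_eq_of_sameCycle hx (sameCycle_subtypeCongr σ ρ (hτ ▸ ?_))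
      exact Quotient.exact (congrArg Subtype.val (Function.surjInv_eq hf (f u)))
  rw [← hrange, LinearMap.finrank_range_of_inj (LinearMap.funLeft_injective_of_surjective ℝ ℝ f hf),
    Module.finrank_fintype_fun_eq_card, Fintype.card_coe]

/-- Deleting a set of minimal elements does not affect compatibility. -/
theorem isCompatible_subtypeCongr_iff {P : Type*} [PartialOrder P] [Finite P] {p : P → Prop}
    [DecidablePred p] (hp : ∀ a, p a → IsMin a) (σ : Equiv.Perm {a // p a})
    (ρ : Equiv.Perm {a // ¬ p a}) : IsCompatible (σ.subtypeCongr ρ) ↔ IsCompatible ρ := by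
  constructor
  · rintro ⟨x, hx, hK⟩
    refine ⟨fun a => x a, fun a => ?_, fun a b hab => hK _ _ hab⟩
    have := hx a
    rwa [Equiv.Perm.subtypeCongr.right_apply_subtype] at this
  · rintro ⟨x, hx, hK⟩
    obtain ⟨m, hm⟩ := (Set.finite_range x).bddBelow
    -- A constant below all values of `x` is invariant under any `σ`, and it keeps the function
    -- strictly monotone because the deleted elements are minimal.
    refine ⟨fun a => if h : p a then m - 1 else x ⟨a, h⟩, fun a => ?_, fun a b hab => ?_⟩
    · by_cases h : p a
      · rw [Equiv.Perm.subtypeCongr.left_apply _ _ h]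
        simp [h, (σ ⟨a, h⟩).2]
      · rw [Equiv.Perm.subtypeCongr.right_apply _ _ h]
        simp only [h, (ρ ⟨a, h⟩).2, dite_false]
        exact hx ⟨a, h⟩
    · have hb : ¬ p b := fun h => (hp b h).not_lt hab
      by_cases h : p a
      · simp only [h, hb, dite_true, dite_false]
        have := hm ⟨⟨b, hb⟩, rfl⟩
        linarith
      · simp only [h, hb, dite_false]
        exact hK ⟨a, h⟩ ⟨b, hb⟩ hab

/-- Pairs of permutations of a set and of its complement are the permutations preserving it. -/
theorem sum_subtypeCongr {α M : Type*} [Fintype α] [DecidableEq α] [AddCommMonoid M]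
    (p : α → Prop) [DecidablePred p] [Fintype {a // p a}] [Fintype {a // ¬ p a}]
    [DecidablePred fun τ : Equiv.Perm α => ∀ a, p (τ a) ↔ p a]
    (f : Equiv.Perm α → M) :
    ∑ σ : Equiv.Perm {a // p a}, ∑ ρ : Equiv.Perm {a // ¬ p a}, f (σ.subtypeCongr ρ) =
      ∑ τ : Equiv.Perm α with ∀ a, p (τ a) ↔ p a, f τ := by
  rw [← Fintype.sum_prod_type' (f := fun σ ρ => f (Equiv.Perm.subtypeCongr σ ρ))]
  refine Finset.sum_bij (fun q _ => Equiv.Perm.subtypeCongr q.1 q.2) ?_ ?_ ?_ fun _ _ => rfl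
  · rintro ⟨σ, ρ⟩ _
    simp only [Finset.mem_filter, Finset.mem_univ, true_and]
    intro a
    by_cases h : p a
    · simp [Equiv.Perm.subtypeCongr.left_apply _ _ h, h, (σ ⟨a, h⟩).2]
    · simp [Equiv.Perm.subtypeCongr.right_apply _ _ h, h, (ρ ⟨a, h⟩).2]
  · intro q _ q' _ h
    exact Equiv.Perm.subtypeCongrHom_injective p h
  · intro τ hτ
    have hτ := (Finset.mem_filter.1 hτ).2
    refine ⟨(τ.subtypePerm hτ, τ.subtypePerm fun a => not_congr (hτ a)), Finset.mem_univ _, ?_⟩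
    ext a
    by_cases h : p a
    · simp [Equiv.Perm.subtypeCongr.left_apply _ _ h]
    · simp [Equiv.Perm.subtypeCongr.right_apply _ _ h]

open Classical in
/-- The invariant sets of minimal elements of a compatible permutation cancel in pairs. -/
theorem sum_neg_one_pow_card_orbits {P : Type*} [PartialOrder P] [Fintype P] [Nonempty P]
    {τ : Equiv.Perm P} (hτ : IsCompatible τ) :
    ∑ U : Finset P with (∀ a ∈ U, IsMin a) ∧ ∀ a, τ a ∈ U ↔ a ∈ U,
      (-1 : ℤ) ^ (U.image (Quotient.mk (Equiv.Perm.SameCycle.setoid τ))).card = 0 := by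
  set S := Equiv.Perm.SameCycle.setoid τ
  -- The orbits consisting of minimal elements only; the admissible `U` correspond to the subsets of
  -- `M`.
  let M : Finset (Quotient S) := Finset.univ.filter fun q => ∀ a, Quotient.mk S a = q → IsMin a
  have hM : M.Nonempty := by
    obtain ⟨x, hx, hK⟩ := hτ
    obtain ⟨p, hp⟩ := Finite.exists_min x
    -- On the orbit of a minimum point of `x`, the function `x` is constantly minimal, so strict
    -- monotonicity leaves nothing below any of its elements.
    refine ⟨Quotient.mk S p, Finset.mem_filter.2 ⟨Finset.mem_univ _, fun a ha => ?_⟩⟩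
    have hap : x a = x p := apply_eq_of_sameCycle hx (Quotient.exact ha)
    rw [isMin_iff_forall_not_lt]
    intro b hb
    have h₁ := hK _ _ hb
    have h₂ := hp b
    linarith
  rw [← Finset.sum_powerset_neg_one_pow_card_of_nonempty hM]
  have hinv : ∀ {U : Finset P}, (∀ a, τ a ∈ U ↔ a ∈ U) → ∀ {a b}, τ.SameCycle a b → a ∈ U →
      b ∈ U := by
    intro U hU a b hab ha
    obtain ⟨n, -, -, rfl⟩ := hab.exists_pow_eq'
    clear hab
    induction n with
    | zero => exact ha
    | succ n ih => rw [pow_succ', Equiv.Perm.mul_apply, hU]; exact ih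
  refine Finset.sum_bij' (fun U _ => U.image (Quotient.mk S))
    (fun D _ => Finset.univ.filter fun a => Quotient.mk S a ∈ D) ?_ ?_ ?_ ?_ fun _ _ => rfl
  · intro U hU
    obtain ⟨h₁, h₂⟩ := (Finset.mem_filter.1 hU).2
    rw [Finset.mem_powerset]
    intro q hq
    obtain ⟨u, hu, rfl⟩ := Finset.mem_image.1 hq
    exact Finset.mem_filter.2 ⟨Finset.mem_univ _, fun a ha =>
      h₁ a (hinv h₂ (Quotient.exact ha.symm) hu)⟩
  · intro D hD
    rw [Finset.mem_powerset] at hD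
    simp only [Finset.mem_filter, Finset.mem_univ, true_and]
    refine ⟨fun a ha => (Finset.mem_filter.1 (hD ha)).2 a rfl, fun a => ?_⟩
    have : Quotient.mk S (τ a) = Quotient.mk S a :=
      Quotient.sound (Equiv.Perm.sameCycle_apply_left.2 (Equiv.Perm.SameCycle.refl _ _))
    rw [this]
  · intro U hU
    obtain ⟨h₁, h₂⟩ := (Finset.mem_filter.1 hU).2
    ext a
    simp only [Finset.mem_filter, Finset.mem_univ, true_and, Finset.mem_image]
    constructor
    · rintro ⟨u, hu, h⟩
      exact hinv h₂ (Quotient.exact h) hu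
    · intro ha
      exact ⟨a, ha, rfl⟩
  · intro D hD
    ext q
    simp only [Finset.mem_filter, Finset.mem_univ, true_and, Finset.mem_image]
    constructor
    · rintro ⟨u, hu, rfl⟩
      exact hu
    · intro hq
      obtain ⟨a, rfl⟩ := Quotient.exists_rep q
      exact ⟨a, hq, rfl⟩

open Classical in
/-- The recursion obtained by deleting sets of minimal elements. -/
theorem sum_prod_mul_posetPoin_eq_zero (P : Type*) [PartialOrder P] [Fintype P] [Nonempty P]
    [DecidableEq P] [DecidablePred fun U : Finset P => ∀ a ∈ U, IsMin a] :
    ∑ U : Finset P with ∀ a ∈ U, IsMin a,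
      (∏ i ∈ Finset.range U.card, (Polynomial.C (i : ℤ) * Polynomial.X - 1)) *
        posetPoin {a // ¬ a ∈ U} = 0 := by
  have hU : ∀ U : Finset P, (∀ a ∈ U, IsMin a) →
      (∏ i ∈ Finset.range U.card, (Polynomial.C (i : ℤ) * Polynomial.X - 1)) *
        posetPoin {a // ¬ a ∈ U} = ∑ τ : Equiv.Perm P with ∀ a, τ a ∈ U ↔ a ∈ U,
        if IsCompatible τ then (-1 : Polynomial ℤ) ^
          (U.image (Quotient.mk (Equiv.Perm.SameCycle.setoid τ))).card *
            Polynomial.X ^ permCodim τ else 0 := by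
    intro U hmin
    rw [← sum_subtypeCongr (fun a => a ∈ U), posetPoin_eq_sum_perm]
    have h₁ : ∏ i ∈ Finset.range U.card, (Polynomial.C (i : ℤ) * Polynomial.X - 1) =
        ∑ σ : Equiv.Perm {a // a ∈ U}, (-1 : Polynomial ℤ) ^ Module.finrank ℝ (fixedFunctions σ) *
          Polynomial.X ^ permCodim σ := by
      -- Take s = -t and extract a sign from each factor; since |U| is codimension plus number of
      -- orbits, the codimension signs cancel and the orbit signs remain.
      have h := sum_pow_permCodim (-Polynomial.X : Polynomial ℤ) {a // a ∈ U}
      rw [Fintype.card_coe] at h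
      calc _ = (-1) ^ U.card * ∏ i ∈ Finset.range U.card, (1 + (i : Polynomial ℤ) *
            -Polynomial.X) := by
            rw [← Finset.card_range U.card, ← Finset.prod_const, Finset.card_range,
              ← Finset.prod_mul_distrib]
            refine Finset.prod_congr rfl fun i _ => ?_
            simp
            ring
        _ = _ := by
            rw [← h, Finset.mul_sum]
            refine Finset.sum_congr rfl fun σ _ => ?_
            have hc := permCodim_add_finrank σ
            rw [Fintype.card_coe] at hc
            rw [← hc, neg_pow (Polynomial.X : Polynomial ℤ), pow_add]
            have : ((-1 : Polynomial ℤ) ^ permCodim σ) * (-1) ^ permCodim σ = 1 := by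
              rw [← mul_pow]; simp
            linear_combination ((-1) ^ Module.finrank ℝ (fixedFunctions σ) *
              Polynomial.X ^ permCodim σ) * this
    rw [h₁, Finset.sum_mul_sum]
    refine Finset.sum_congr rfl fun σ _ => ?_
    rw [Finset.sum_filter]
    refine Finset.sum_congr rfl fun ρ _ => ?_
    rw [← finrank_fixedFunctions_eq_card_image σ ρ _ rfl, permCodim_subtypeCongr, pow_add]
    simp only [isCompatible_subtypeCongr_iff hmin]
    split_ifs
    · ring
    · rfl
  rw [Finset.sum_congr rfl fun U h => hU U (Finset.mem_filter.1 h).2]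
  simp_rw [Finset.sum_filter]
  rw [← Finset.sum_filter, Finset.sum_comm]
  refine Finset.sum_eq_zero fun τ _ => ?_
  by_cases hτ : IsCompatible τ
  · have := congrArg (fun n : ℤ => (n : Polynomial ℤ) * Polynomial.X ^ permCodim τ)
      (sum_neg_one_pow_card_orbits hτ)
    simp only [Int.cast_sum, Int.cast_pow, Int.cast_neg, Int.cast_one, Int.cast_zero, zero_mul,
      Finset.sum_mul] at this
    rw [← Finset.filter_filter, Finset.sum_filter] at this
    simp only [hτ, if_true]
    convert this
  · simp [hτ]

/-! ### Disjoint unions of chains -/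

open Classical in
theorem posetPoin_congr {P Q : Type*} [PartialOrder P] [PartialOrder Q] [Finite P] [Finite Q]
    (e : P ≃o Q) : posetPoin P = posetPoin Q := by
  have := Fintype.ofFinite P
  have := Fintype.ofFinite Q
  rw [posetPoin_eq_sum_perm, posetPoin_eq_sum_perm, Finset.sum_filter, Finset.sum_filter]
  refine Fintype.sum_equiv e.toEquiv.permCongr _ _ fun σ => ?_
  rw [permCodim_permCongr]
  have : IsCompatible (e.toEquiv.permCongr σ) ↔ IsCompatible σ := by
    constructor
    · rintro ⟨x, hx, hK⟩
      refine ⟨x ∘ e, fun p => ?_, fun p q h => hK _ _ (e.lt_iff_lt.2 h)⟩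
      have := hx (e p)
      simpa using this
    · rintro ⟨x, hx, hK⟩
      refine ⟨x ∘ e.symm, fun p => ?_, fun p q h => hK _ _ (e.symm.lt_iff_lt.2 h)⟩
      have := hx (e.symm p)
      simpa using this
  simp only [this]

theorem posetPoin_of_isEmpty (P : Type*) [PartialOrder P] [Finite P] [IsEmpty P] :
    posetPoin P = 1 := by
  classical
  have := Fintype.ofFinite P
  rw [posetPoin_eq_sum_perm, Finset.sum_filter, Fintype.sum_subsingleton _ 1, permCodim_of_isEmpty,
    if_pos, pow_zero]
  exact ⟨0, fun p => isEmptyElim p, fun p => isEmptyElim p⟩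

/-- The least elements of the chains indexed by `T`. -/
def chainBottoms {ℓ : ℕ} (a : Fin ℓ → ℕ) (T : Finset (Fin ℓ)) : Finset (ChainUnion a) :=
  Finset.univ.filter fun p => p.2.val = 0 ∧ p.1 ∈ T

theorem mem_chainBottoms {ℓ : ℕ} {a : Fin ℓ → ℕ} {T : Finset (Fin ℓ)} {p : ChainUnion a} :
    p ∈ chainBottoms a T ↔ p.2.val = 0 ∧ p.1 ∈ T := by
  simp [chainBottoms]

theorem chainUnion_le_iff {ℓ : ℕ} {a : Fin ℓ → ℕ} {p q : ChainUnion a} :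
    p ≤ q ↔ p.1 = q.1 ∧ p.2.val ≤ q.2.val := by
  rcases p with ⟨i, k⟩
  rcases q with ⟨j, l⟩
  by_cases h : i = j
  · subst h
    simp [Sigma.mk_le_mk_iff]
  · simp [Sigma.le_def, h]

theorem chainUnion_ext {ℓ : ℕ} {a : Fin ℓ → ℕ} {p q : ChainUnion a} (h₁ : p.1 = q.1)
    (h₂ : p.2.val = q.2.val) : p = q :=
  le_antisymm (chainUnion_le_iff.2 ⟨h₁, h₂.le⟩) (chainUnion_le_iff.2 ⟨h₁.symm, h₂.ge⟩)

theorem isMin_chainUnion_iff {ℓ : ℕ} {a : Fin ℓ → ℕ} {p : ChainUnion a} :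
    IsMin p ↔ p.2.val = 0 := by
  constructor
  · intro h
    have h' := h (b := ⟨p.1, ⟨0, p.2.pos⟩⟩) (chainUnion_le_iff.2 ⟨rfl, Nat.zero_le _⟩)
    simpa using (chainUnion_le_iff.1 h').2
  · intro h q hq
    rw [chainUnion_le_iff] at hq ⊢
    exact ⟨hq.1.symm, by omega⟩

/-- Deleting the bottoms of the chains indexed by `T` shortens these chains by one. -/
def chainUnionDeleteBottoms {ℓ : ℕ} {a b : Fin ℓ → ℕ} {T : Finset (Fin ℓ)}
    (h : ∀ i, a i = b i + if i ∈ T then 1 else 0) :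
    ChainUnion b ≃o {p : ChainUnion a // ¬ p ∈ chainBottoms a T} where
  toFun p := ⟨⟨p.1, ⟨p.2.val + if p.1 ∈ T then 1 else 0, by
      have := h p.1; have := p.2.isLt; omega⟩⟩, by
    rw [mem_chainBottoms]
    rintro ⟨h₁, h₂⟩
    simp [h₂] at h₁⟩
  invFun p := ⟨p.1.1, ⟨p.1.2.val - if p.1.1 ∈ T then 1 else 0, by
      have h₁ := h p.1.1
      have h₂ := p.1.2.isLt
      have h₃ := p.2
      rw [mem_chainBottoms] at h₃
      split_ifs at * with hT
      -- The bottoms of the chains in `T` are deleted, so the natural-number subtraction does not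
      -- truncate here.
      · have : p.1.2.val ≠ 0 := fun h₀ => h₃ ⟨h₀, hT⟩
        omega
      · omega⟩⟩
  left_inv p := chainUnion_ext rfl (by simp)
  right_inv p := Subtype.ext (chainUnion_ext rfl (by
    have h₃ := p.2
    rw [mem_chainBottoms] at h₃
    dsimp only
    split_ifs with hT
    · have : p.1.2.val ≠ 0 := fun h₀ => h₃ ⟨h₀, hT⟩
      omega
    · omega))
  map_rel_iff' := by
    intro p q
    rw [Equiv.coe_fn_mk, Subtype.mk_le_mk, chainUnion_le_iff, chainUnion_le_iff]
    refine and_congr_right fun hpq => ?_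
    change p.2.val + (if p.1 ∈ T then 1 else 0) ≤ q.2.val + (if q.1 ∈ T then 1 else 0) ↔ _
    have : (if p.1 ∈ T then 1 else 0) = if q.1 ∈ T then 1 else 0 := by
      change p.1 = q.1 at hpq
      simp only [hpq]
    rw [this, add_le_add_iff_right]

-- The recursion on minimal elements, reindexed by sets of nonempty chains. The shortened lengths `b
-- T` are constrained only for such sets, so a truncated difference may be supplied for them.
open Classical in
theorem sum_chainUnion_eq_zero {ℓ : ℕ} (a : Fin ℓ → ℕ) (ha : a ≠ 0)
    (b : Finset (Fin ℓ) → Fin ℓ → ℕ)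
    (hb : ∀ T : Finset (Fin ℓ), (∀ i ∈ T, a i ≠ 0) → ∀ i, a i = b T i + if i ∈ T then 1 else 0) :
    ∑ T : Finset (Fin ℓ) with ∀ i ∈ T, a i ≠ 0,
      (∏ i ∈ Finset.range T.card, (Polynomial.C (i : ℤ) * Polynomial.X - 1)) *
        posetPoin (ChainUnion (b T)) = 0 := by
  obtain ⟨i₀, hi₀⟩ := Function.ne_iff.1 ha
  have : Nonempty (ChainUnion a) := ⟨⟨i₀, ⟨0, Nat.pos_of_ne_zero hi₀⟩⟩⟩
  rw [← sum_prod_mul_posetPoin_eq_zero (ChainUnion a)]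
  have himage : ∀ T : Finset (Fin ℓ), (∀ i ∈ T, a i ≠ 0) →
      (chainBottoms a T).image Sigma.fst = T := by
    intro T hT
    ext i
    simp only [Finset.mem_image, mem_chainBottoms]
    constructor
    · rintro ⟨p, ⟨-, hp⟩, rfl⟩
      exact hp
    · intro hi
      exact ⟨⟨i, ⟨0, Nat.pos_of_ne_zero (hT i hi)⟩⟩, ⟨rfl, hi⟩, rfl⟩
  refine Finset.sum_bij' (fun T _ => chainBottoms a T) (fun U _ => U.image Sigma.fst) ?_ ?_ ?_ ?_ ?_
  · intro T _
    simp only [Finset.mem_filter, Finset.mem_univ, true_and]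
    exact fun p hp => isMin_chainUnion_iff.2 (mem_chainBottoms.1 hp).1
  · intro U _
    simp only [Finset.mem_filter, Finset.mem_univ, true_and]
    intro i hi
    obtain ⟨p, -, rfl⟩ := Finset.mem_image.1 hi
    exact p.2.pos.ne'
  · intro T hT
    exact himage T (Finset.mem_filter.1 hT).2
  · intro U hU
    have hU := (Finset.mem_filter.1 hU).2
    ext p
    rw [mem_chainBottoms, Finset.mem_image]
    constructor
    · rintro ⟨h₁, q, hq, h₂⟩
      rwa [chainUnion_ext h₂.symm (h₁.trans (isMin_chainUnion_iff.1 (hU q hq)).symm)]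
    · intro hp
      exact ⟨isMin_chainUnion_iff.1 (hU p hp), p, hp, rfl⟩
  · intro T hT
    have hT := (Finset.mem_filter.1 hT).2
    have hcard : (chainBottoms a T).card = T.card := by
      conv_rhs => rw [← himage T hT]
      refine (Finset.card_image_of_injOn fun p hp q hq h => chainUnion_ext h ?_).symm
      rw [(mem_chainBottoms.1 hp).1, (mem_chainBottoms.1 hq).1]
    rw [hcard, posetPoin_congr (chainUnionDeleteBottoms (hb T hT))]

/-! ### The generating function -/

/-- The denominator as a sum of monomials over all subsets of the set of variables. -/
theorem one_sub_sum_esymm_eq (ℓ : ℕ) :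
    (1 - ∑ j ∈ Finset.Icc 1 ℓ,
        (MvPolynomial.esymm (Fin ℓ) (Polynomial ℤ) j :
            MvPowerSeries (Fin ℓ) (Polynomial ℤ)) *
          MvPowerSeries.C (∏ i ∈ Finset.Ico 1 j,
            (Polynomial.C (i : ℤ) * Polynomial.X - 1 : Polynomial ℤ))) =
      ∑ T : Finset (Fin ℓ), MvPowerSeries.monomial (∑ i ∈ T, Finsupp.single i 1)
        (∏ i ∈ Finset.range T.card, (Polynomial.C (i : ℤ) * Polynomial.X - 1 : Polynomial ℤ)) := by
  have hj : ∀ j ∈ Finset.Icc 1 ℓ, (MvPolynomial.esymm (Fin ℓ) (Polynomial ℤ) j :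
            MvPowerSeries (Fin ℓ) (Polynomial ℤ)) *
          MvPowerSeries.C (∏ i ∈ Finset.Ico 1 j,
            (Polynomial.C (i : ℤ) * Polynomial.X - 1 : Polynomial ℤ)) =
      -∑ T ∈ Finset.powersetCard j (Finset.univ : Finset (Fin ℓ)),
        MvPowerSeries.monomial (∑ i ∈ T, Finsupp.single i 1)
        (∏ i ∈ Finset.range T.card, (Polynomial.C (i : ℤ) * Polynomial.X - 1 : Polynomial ℤ)) := by
    intro j hj
    have hj := (Finset.mem_Icc.1 hj).1
    rw [MvPolynomial.esymm_eq_sum_monomial, ← MvPolynomial.coeToMvPowerSeries.ringHom_apply,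
      map_sum, Finset.sum_mul, ← Finset.sum_neg_distrib]
    refine Finset.sum_congr rfl fun T hT => ?_
    -- The factor with i = 0 is -1; it accounts for the minus sign before the sum over j. The empty
    -- set T later supplies the leading 1.
    rw [(Finset.mem_powersetCard.1 hT).2, Finset.prod_range_eq_mul_Ico _ hj,
      MvPolynomial.coeToMvPowerSeries.ringHom_apply, MvPolynomial.coe_monomial,
      ← MvPowerSeries.monomial_zero_eq_C_apply, MvPowerSeries.monomial_mul_monomial, add_zero,
      one_mul, ← map_neg]
    congr 1
    simp
  rw [Finset.sum_congr rfl hj, Finset.sum_neg_distrib, sub_neg_eq_add, ← Finset.powerset_univ,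
    Finset.sum_powerset, Finset.card_univ, Fintype.card_fin, Finset.sum_range_eq_add_Ico _ (by omega),
    Finset.powersetCard_zero, Finset.sum_singleton]
  congr 1

theorem theorem1p4 (ℓ : ℕ) (hℓ : 1 ≤ ℓ) :
    chainPoinSeries ℓ *
      (1 - ∑ j ∈ Finset.Icc 1 ℓ,
        (MvPolynomial.esymm (Fin ℓ) (Polynomial ℤ) j :
            MvPowerSeries (Fin ℓ) (Polynomial ℤ)) *
          MvPowerSeries.C (∏ i ∈ Finset.Ico 1 j,
            (Polynomial.C (i : ℤ) * Polynomial.X - 1 : Polynomial ℤ))) = 1 := by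
  classical
  have hs : ∀ (T : Finset (Fin ℓ)) (i : Fin ℓ),
      (∑ k ∈ T, Finsupp.single k 1 : Fin ℓ →₀ ℕ) i = if i ∈ T then 1 else 0 := by
    intro T i
    simp [Finsupp.finsetSum_apply, Finsupp.single_apply]
  have hle : ∀ (a : Fin ℓ →₀ ℕ) (T : Finset (Fin ℓ)),
      ∑ k ∈ T, Finsupp.single k 1 ≤ a ↔ ∀ i ∈ T, a i ≠ 0 := by
    intro a T
    rw [Finsupp.le_def]
    refine forall_congr' fun i => ?_
    rw [hs]
    split_ifs with hi
    · simp [hi, Nat.one_le_iff_ne_zero]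
    · simp [hi]
  rw [one_sub_sum_esymm_eq, Finset.mul_sum]
  ext1 a
  simp only [map_sum, MvPowerSeries.coeff_mul_monomial, hle]
  rw [← Finset.sum_filter, MvPowerSeries.coeff_one]
  split_ifs with ha
  · subst ha
    have : (Finset.univ.filter fun T : Finset (Fin ℓ) =>
        ∀ i ∈ T, (0 : Fin ℓ →₀ ℕ) i ≠ 0) = {∅} := by
      ext T
      simp [Finset.eq_empty_iff_forall_notMem]
    rw [this, Finset.sum_singleton]
    have : IsEmpty (ChainUnion (0 : Fin ℓ →₀ ℕ)) := ⟨fun p => p.2.elim0⟩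
    simpa using! posetPoin_of_isEmpty (ChainUnion (0 : Fin ℓ →₀ ℕ))
  -- The coefficient at `a` is the recursion for chains of lengths `a`; the subtraction is exact
  -- because every chain in `T` is nonempty.
  · rw [← sum_chainUnion_eq_zero a (fun h => ha (DFunLike.coe_injective h))
      (fun T => ⇑(a - ∑ k ∈ T, Finsupp.single k 1 : Fin ℓ →₀ ℕ))]
    · exact Finset.sum_congr rfl fun T _ => mul_comm _ _
    · intro T hT i
      have h := hT i
      rw [Finsupp.tsub_apply, hs]
      split_ifs with hi
      · have := h hi
        omega
      · omega
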